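/- Let $\mathbb T=\mathbb R/\mathbb Z$, let $(\gamma_n)$ be a sequence of positive real numbers with $\gamma_n\to\infty$, and put $p_n(r)=r^{\gamma_n}$, $\lambda_n(r)=r^2p_n'(r)$ and $\pi_n(r)=\frac{\gamma_n}{\gamma_n+1}r^{\gamma_n+1}$. Let $T>0$. For $\rho_n^0,u_n^0\in H^4(\mathbb T)$ with $\rho_n^0>0$, a regular solution on $[0,T]$ with initial data $(\rho_n^0,u_n^0)$ is a pair $(\rho_n,u_n)$ with $\rho_n\in C([0,T];H^4(\mathbb T))$, $u_n\in C([0,T];H^4(\mathbb T))\cap L^2(0,T;H^5(\mathbb T))$ and $(\rho_n,u_n)|_{t=0}=(\rho_n^0,u_n^0)$ that satisfies, on $\mathbb T\times[0,T]$, $$\partial_t\rho_n+\partial_x(\rho_nu_n)=0,\qquad \partial_t(\rho_nu_n)+\partial_x(\rho_nu_n^2)-\partial_x(\lambda_n(\rho_n)\partial_xu_n)=0 .$$ Let $w_n^0=u_n^0+\partial_xp_n(\rho_n^0)$. Let $C,\underline\rho^0,\hat\rho$ be real constants with $\underline\rho^0>0$ and $\hat\rho<1$. Then there is a constant $K$,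 depending only on $(\gamma_n)$, $T$, $C$, $\underline\rho^0$ and $\hat\rho$ (in particular not on $n$), such that for every $n$ and all initial data $(\rho_n^0,u_n^0)$ as above with $$\underline\rho^0\le\rho_n^0(x)\le1+\tfrac1{\gamma_n}\ \ (x\in\mathbb T),\qquad \big\|\sqrt{\rho_n^0}\,u_n^0\big\|_{L^2_x}+\big\|\sqrt{\rho_n^0}\,w_n^0\big\|_{L^2_x}\le C,$$ $$\operatorname*{ess\,sup}_{x\in\mathbb T}\partial_xw_n^0+\|\partial_xw_n^0\|_{L^2_x}\le C,\qquad \int_{\mathbb T}\rho_n^0\,dx\le\hat\rho ,$$ every regular solution $(\rho_n,u_n)$ on $[0,T]$ with initial data $(\rho_n^0,u_n^0)$ has the property that $\pi_n(\rho_n)$ is differentiable in $x$ on $\mathbb T\times[0,T]$ and $$\|\pi_n(\rho_n)\|_{L^\infty(0,T;L^1(\mathbb T))}+\|\partial_x\pi_n(\rho_n)\|_{L^\infty(0,T;L^2(\mathbb T))}\le K .$$ -/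

import Mathlib

open MeasureTheory Filter Set
open scoped ENNReal Topology

noncomputable section

namespace AwRascle

/-- The one-dimensional torus `ℝ / ℤ`; its `volume` has total mass one. -/
abbrev Torus : Type := UnitAddCircle

/-- The (classical) spatial derivative `∂ₓ f` of a function on the torus. -/
def dx (f : Torus → ℝ) (x : Torus) : ℝ :=
  deriv (fun h : ℝ => f (x + (h : Torus))) 0

/-- The norm of the Sobolev space `H^k` of the torus, through Fourier coefficients,
`‖f‖² = ∑ₘ (1 + m²)^k |f̂(m)|²`, with the value `∞` for square-integrable functions outside `H^k`. -/
def hNorm (k : ℕ) (f : Torus → ℝ) : ℝ≥0∞ :=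
  (∑' m : ℤ, ENNReal.ofReal ((1 + (m : ℝ) ^ 2) ^ k) *
    ‖fourierCoeff (T := (1 : ℝ)) (fun x => (f x : ℂ)) m‖ₑ ^ 2) ^ (1 / 2 : ℝ)

/-- `f ∈ H^k` of the torus, `k ≥ 1`. As usual in one dimension, an element of `H^k` is identified
with its continuous representative. -/
def MemH (k : ℕ) (f : Torus → ℝ) : Prop :=
  Continuous f ∧ hNorm k f < ∞

/-- `f ∈ C([0,T]; H^k)`. -/
def ContH (k : ℕ) (T : ℝ) (f : ℝ → Torus → ℝ) : Prop :=
  (∀ t ∈ Icc 0 T, MemH k (f t)) ∧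
    ∀ t ∈ Icc 0 T,
      Tendsto (fun s => hNorm k (fun x => f s x - f t x)) (𝓝[Icc 0 T] t) (𝓝 0)

/-- The cost `p(r) = r ^ γ`. -/
def p (γ r : ℝ) : ℝ := r ^ γ

/-- The diffusion coefficient `λ(r) = r² p'(r)`. -/
def lam (γ r : ℝ) : ℝ := r ^ 2 * deriv (p γ) r

/-- The potential `π(r) = γ / (γ + 1) * r ^ (γ + 1)`. -/
def potential (γ r : ℝ) : ℝ := γ / (γ + 1) * r ^ (γ + 1)

/-- The desired velocity `w = u + ∂ₓ p(ρ)`. -/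
def desiredVelocity (γ : ℝ) (ρ u : Torus → ℝ) (x : Torus) : ℝ :=
  u x + dx (fun y => p γ (ρ y)) x

/-- `(ρ, u)` is a regular solution on `[0,T]`, with initial data `(ρ₀, u₀)`, of
`∂ₜ ρ + ∂ₓ (ρ u) = 0`, `∂ₜ (ρ u) + ∂ₓ (ρ u²) - ∂ₓ (λ(ρ) ∂ₓ u) = 0`.
Time derivatives are one-sided at the two end points of `[0,T]`. -/
structure IsRegularSolution (γ T : ℝ) (ρ₀ u₀ : Torus → ℝ) (ρ u : ℝ → Torus → ℝ) : Prop where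
  memH_ρ₀ : MemH 4 ρ₀
  memH_u₀ : MemH 4 u₀
  ρ₀_pos : ∀ x, 0 < ρ₀ x
  initial_ρ : ρ 0 = ρ₀
  initial_u : u 0 = u₀
  contH_ρ : ContH 4 T ρ
  contH_u : ContH 4 T u
  /-- `u ∈ L²(0,T; H⁵)` -/
  sqIntegrable_u : ∫⁻ t in Icc 0 T, hNorm 5 (u t) ^ 2 < ∞
  continuity_eq : ∀ t ∈ Icc 0 T, ∀ x,
    HasDerivWithinAt (fun s => ρ s x) (-dx (fun y => ρ t y * u t y) x) (Icc 0 T) t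
  momentum_eq : ∀ t ∈ Icc 0 T, ∀ x,
    HasDerivWithinAt (fun s => ρ s x * u s x)
      (-dx (fun y => ρ t y * u t y ^ 2) x + dx (fun y => lam γ (ρ t y) * dx (u t) y) x)
      (Icc 0 T) t

/-- The bounds on the initial data; `C`, `ρlow`, `ρhat` are the constants in them. -/
structure InitialBounds (γ C ρlow ρhat : ℝ) (ρ₀ u₀ : Torus → ℝ) : Prop where
  lower : ∀ x, ρlow ≤ ρ₀ x
  upper : ∀ x, ρ₀ x ≤ 1 + 1 / γ
  energy :
    eLpNorm (fun x => √(ρ₀ x) * u₀ x) 2 volume +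
      eLpNorm (fun x => √(ρ₀ x) * desiredVelocity γ ρ₀ u₀ x) 2 volume ≤ ENNReal.ofReal C
  velocity_gradient :
    essSup (fun x => ((dx (desiredVelocity γ ρ₀ u₀) x : ℝ) : EReal)) volume +
      ((eLpNorm (dx (desiredVelocity γ ρ₀ u₀)) 2 volume : ℝ≥0∞) : EReal) ≤ (C : EReal)
  mean : ⨍ x, ρ₀ x ≤ ρhat

/-- The norm of `L^∞(0,T; L^q)`. -/
def normLinftyLq (T : ℝ) (q : ℝ≥0∞) (f : ℝ → Torus → ℝ) : ℝ≥0∞ :=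
  essSup (fun t => eLpNorm (f t) q volume) (volume.restrict (Icc 0 T))

end AwRascle

end

/-!
The potential satisfies `∂ₓ π(ρ) = ρ ∂ₓ p(ρ) = ρ (w - u)`, where `w = u + ∂ₓ p(ρ)` is the desired
velocity, so it is controlled by the energies of `u` and `w`. Both are bounded by their initial
values. For `u` this is the dissipation of kinetic energy, `d/dt ∫ ρ u² = -2 ∫ λ(ρ) (∂ₓ u)²`
(`integral_energy_le`). For `w` it holds because the diffusion in the momentum equation cancels
against the evolution of `∂ₓ π(ρ)`, which leaves `∂ₜ (ρ w) + ∂ₓ (ρ u w) = 0`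
(`desiredMomentum_eq`, `integral_desired_energy_le`). Hence `∫ ρ (w - u)² ≤ 4 C²`.

The mass is conserved and less than one, so at each time `ρ ≤ 1`, and with it `π(ρ) ≤ 1`, at some
point. The oscillation of `π(ρ)` is at most `∫ ρ |w - u| ≤ ½ ∫ ρ + ½ ∫ ρ (w - u)²`. This gives a
pointwise bound on `π(ρ)` that does not depend on `γ` (`potential_le`). It bounds `ρ` uniformly for
`γ` away from zero (`le_of_potential_le`), and then `∫ (∂ₓ π(ρ))² ≤ sup ρ · ∫ ρ (w - u)²` is bounded
as well.

These computations are classical because `H⁴` embeds into `C²`, uniformly enough to make the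
derivatives continuous in time and space (`continuousOn_fourierDeriv`), and because the density
stays positive (`pos_of_continuity_eq`). The evolution of `∂ₓ π(ρ)` needs one exchange of
derivatives in time and space (`hasDerivWithinAt_swap`).
-/

namespace AwRascle

/-! ### The embedding of `H⁴` into `C²` on the torus -/

/-- The `k`-th derivative of the lift to `ℝ` of a function on the torus, as the termwise
differentiated Fourier series. It is the classical derivative when `f ∈ H⁴` and `k ≤ 2`. -/
noncomputable def fourierDeriv (k : ℕ) (f : Torus → ℝ) (x : ℝ) : ℝ :=
  (∑' m : ℤ, (2 * Real.pi * Complex.I * m) ^ k *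
    fourierCoeff (T := (1 : ℝ)) (fun y => (f y : ℂ)) m * fourier m (x : Torus)).re

/-- The constant of the embedding of `H⁴` into the functions with `∑ (1 + m²) |f̂(m)| < ∞`. -/
noncomputable def embeddingConst : ℝ≥0∞ :=
  (∑' m : ℤ, ENNReal.ofReal ((1 + (m : ℝ) ^ 2)⁻¹) ^ (2 : ℝ)) ^ (1 / 2 : ℝ)

theorem embeddingConst_ne_top : embeddingConst ≠ ∞ := by
  refine ENNReal.rpow_ne_top_of_nonneg (by norm_num) ?_
  have h1 : Summable fun m : ℤ => ((1 + (m : ℝ) ^ 2)⁻¹) ^ 2 := by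
    refine Summable.of_norm_bounded_eventually
      (Real.summable_one_div_int_pow (p := 2) |>.mpr one_lt_two) ?_
    have : ({0}ᶜ : Set ℤ) ∈ cofinite := (finite_singleton 0).compl_mem_cofinite
    filter_upwards [this] with m hm
    have hm' : (1 : ℝ) ≤ (m : ℝ) ^ 2 := by
      have : (1 : ℤ) ≤ m ^ 2 := by
        have : 0 < m ^ 2 := by have : m ≠ 0 := hm; positivity
        omega
      exact_mod_cast this
    rw [Real.norm_of_nonneg (by positivity), one_div, inv_pow]
    apply inv_anti₀ (by positivity)
    nlinarith
  have h2 := h1.tsum_ofReal_ne_top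
  convert h2 using 3 with m
  rw [ENNReal.ofReal_pow (by positivity)]
  exact_mod_cast rfl

/-- Cauchy-Schwarz against the weights `(1 + m²)⁻¹`. -/
theorem tsum_fourierCoeff_le (f : Torus → ℝ) :
    ∑' m : ℤ, ENNReal.ofReal (1 + (m : ℝ) ^ 2) *
      ‖fourierCoeff (T := (1 : ℝ)) (fun y => (f y : ℂ)) m‖ₑ ≤ embeddingConst * hNorm 4 f := by
  set c := fourierCoeff (T := (1 : ℝ)) (fun y => (f y : ℂ))
  have h := ENNReal.lintegral_mul_le_Lp_mul_Lq (Measure.count : Measure ℤ)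
    (Real.HolderConjugate.two_two)
    (f := fun m : ℤ => ENNReal.ofReal ((1 + (m : ℝ) ^ 2)⁻¹))
    (g := fun m : ℤ => ENNReal.ofReal ((1 + (m : ℝ) ^ 2) ^ 2) * ‖c m‖ₑ)
    (Measurable.of_discrete.aemeasurable) (Measurable.of_discrete.aemeasurable)
  simp only [lintegral_count] at h
  refine (le_of_eq ?_).trans (h.trans (le_of_eq ?_))
  · refine tsum_congr fun m => ?_
    simp only [Pi.mul_apply]
    rw [← mul_assoc, ← ENNReal.ofReal_mul (by positivity)]
    congr 2
    field_simp
  · unfold embeddingConst hNorm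
    congr 2
    refine tsum_congr fun m => ?_
    rw [ENNReal.mul_rpow_of_nonneg _ _ (by norm_num)]
    simp only [ENNReal.rpow_ofNat]
    rw [← ENNReal.ofReal_pow (by positivity), ← pow_mul]

theorem enorm_fourierDeriv_term_le {k : ℕ} (hk : k ≤ 2) (c : ℂ) (m : ℤ) (x : ℝ) :
    ‖(2 * Real.pi * Complex.I * m) ^ k * c * fourier m (x : Torus)‖ₑ ≤
      ENNReal.ofReal ((2 * Real.pi) ^ 2) * (ENNReal.ofReal (1 + (m : ℝ) ^ 2) * ‖c‖ₑ) := by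
  rw [← ofReal_norm, ← ofReal_norm, ← ENNReal.ofReal_mul (by positivity),
    ← ENNReal.ofReal_mul (by positivity)]
  refine ENNReal.ofReal_le_ofReal ?_
  have h1 : ‖(fourier m (x : Torus) : ℂ)‖ = 1 := by
    rw [fourier_apply]; exact Circle.norm_coe _
  have hpi := Real.two_le_pi
  rw [norm_mul, h1, mul_one, norm_mul, norm_pow, ← mul_assoc]
  refine mul_le_mul_of_nonneg_right ?_ (norm_nonneg _)
  simp only [norm_mul, Complex.norm_ofNat, Complex.norm_real, Complex.norm_I, mul_one,
    Complex.norm_intCast, Real.norm_of_nonneg Real.pi_pos.le]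
  rw [mul_pow, ← sq_abs (m : ℝ)]
  have hp : (2 * Real.pi) ^ k ≤ (2 * Real.pi) ^ 2 := pow_le_pow_right₀ (by linarith) hk
  have hm : |(m : ℝ)| ^ k ≤ 1 + |(m : ℝ)| ^ 2 := by
    interval_cases k <;> nlinarith [abs_nonneg (m : ℝ), sq_nonneg (|(m : ℝ)| - 1)]
  gcongr

/-- The embedding estimate. It needs no finiteness of the norm, so it applies to differences of
elements of `H⁴` directly. -/
theorem enorm_fourierDeriv_le {k : ℕ} (hk : k ≤ 2) (f : Torus → ℝ) (x : ℝ) :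
    ‖fourierDeriv k f x‖ₑ ≤
      ENNReal.ofReal ((2 * Real.pi) ^ 2) * embeddingConst * hNorm 4 f := by
  calc ‖fourierDeriv k f x‖ₑ ≤ ‖∑' m : ℤ, (2 * Real.pi * Complex.I * m) ^ k *
          fourierCoeff (T := (1 : ℝ)) (fun y => (f y : ℂ)) m * fourier m (x : Torus)‖ₑ := by
        rw [fourierDeriv, ← ofReal_norm, ← ofReal_norm]
        exact ENNReal.ofReal_le_ofReal (Complex.abs_re_le_norm _)
    _ ≤ ∑' m : ℤ, _ := enorm_tsum_le_tsum_enorm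
    _ ≤ ∑' m : ℤ, ENNReal.ofReal ((2 * Real.pi) ^ 2) * _ :=
        ENNReal.tsum_le_tsum fun m => enorm_fourierDeriv_term_le hk _ m x
    _ ≤ _ := by
        rw [ENNReal.tsum_mul_left, mul_assoc]
        gcongr
        exact tsum_fourierCoeff_le f

theorem summable_fourierCoeff_weighted {f : Torus → ℝ} (hf : MemH 4 f) :
    Summable fun m : ℤ => (2 * Real.pi) ^ 2 * ((1 + (m : ℝ) ^ 2) *
      ‖fourierCoeff (T := (1 : ℝ)) (fun y => (f y : ℂ)) m‖) := by
  refine Summable.mul_left _ ?_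
  have h : ∑' m : ℤ, ENNReal.ofReal ((1 + (m : ℝ) ^ 2) *
      ‖fourierCoeff (T := (1 : ℝ)) (fun y => (f y : ℂ)) m‖) ≠ ∞ := by
    refine ne_top_of_le_ne_top (ENNReal.mul_ne_top embeddingConst_ne_top hf.2.ne)
      (le_trans (le_of_eq ?_) (tsum_fourierCoeff_le f))
    refine tsum_congr fun m => ?_
    rw [ENNReal.ofReal_mul (by positivity), ofReal_norm]
  refine (ENNReal.summable_toReal h).congr fun m => ?_
  rw [ENNReal.toReal_ofReal (by positivity)]

theorem norm_fourierDeriv_term_le {k : ℕ} (hk : k ≤ 2) (c : ℂ) (m : ℤ) (x : ℝ) :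
    ‖(2 * Real.pi * Complex.I * m) ^ k * c * fourier m (x : Torus)‖ ≤
      (2 * Real.pi) ^ 2 * ((1 + (m : ℝ) ^ 2) * ‖c‖) := by
  have h := enorm_fourierDeriv_term_le hk c m x
  rw [← ofReal_norm, ← ofReal_norm, ← ENNReal.ofReal_mul (by positivity),
    ← ENNReal.ofReal_mul (by positivity)] at h
  exact (ENNReal.ofReal_le_ofReal_iff (by positivity)).1 h

theorem summable_fourierDeriv_term {k : ℕ} (hk : k ≤ 2) {f : Torus → ℝ} (hf : MemH 4 f) (x : ℝ) :
    Summable fun m : ℤ => (2 * Real.pi * Complex.I * m) ^ k *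
      fourierCoeff (T := (1 : ℝ)) (fun y => (f y : ℂ)) m * fourier m (x : Torus) :=
  Summable.of_norm_bounded (summable_fourierCoeff_weighted hf)
    fun m => norm_fourierDeriv_term_le hk _ m x

theorem hasDerivAt_fourierDeriv {k : ℕ} (hk : k + 1 ≤ 2) {f : Torus → ℝ} (hf : MemH 4 f) (x : ℝ) :
    HasDerivAt (fourierDeriv k f) (fourierDeriv (k + 1) f x) x := by
  have h := hasDerivAt_tsum (𝕜 := ℝ) (y₀ := 0) (summable_fourierCoeff_weighted hf)
    (g := fun (m : ℤ) (x : ℝ) => (2 * Real.pi * Complex.I * m) ^ k *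
      fourierCoeff (T := (1 : ℝ)) (fun y => (f y : ℂ)) m * fourier m (x : Torus))
    (g' := fun (m : ℤ) (x : ℝ) => (2 * Real.pi * Complex.I * m) ^ (k + 1) *
      fourierCoeff (T := (1 : ℝ)) (fun y => (f y : ℂ)) m * fourier m (x : Torus))
    (fun m y => by
      have := (hasDerivAt_fourier 1 m y).const_mul ((2 * Real.pi * Complex.I * m) ^ k *
        fourierCoeff (T := (1 : ℝ)) (fun y => (f y : ℂ)) m)
      refine this.congr_deriv ?_
      push_cast
      ring)
    (fun m y => norm_fourierDeriv_term_le hk _ m y)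
    (summable_fourierDeriv_term (by omega) hf 0) x
  exact (Complex.reCLM.hasFDerivAt.comp_hasDerivAt x h)

theorem fourierDeriv_zero {f : Torus → ℝ} (hf : MemH 4 f) (x : ℝ) :
    fourierDeriv 0 f x = f x := by
  let g : C(AddCircle (1 : ℝ), ℂ) := ⟨fun y => (f y : ℂ), Complex.continuous_ofReal.comp hf.1⟩
  have hs : Summable (fourierCoeff g) := by
    refine Summable.of_norm_bounded (summable_fourierCoeff_weighted hf) fun m => ?_
    simpa [g, fourier_apply] using norm_fourierDeriv_term_le (k := 0) (by norm_num)
      (fourierCoeff (T := (1 : ℝ)) (fun y => (f y : ℂ)) m) m 0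
  have h := has_pointwise_sum_fourier_series_of_summable hs (x : AddCircle (1 : ℝ))
  have h' := h.tsum_eq
  simp only [smul_eq_mul] at h'
  simp only [fourierDeriv, pow_zero, one_mul]
  exact (congrArg Complex.re h').trans (Complex.ofReal_re _)

theorem fourierDeriv_sub {k : ℕ} (hk : k ≤ 2) {f g : Torus → ℝ} (hf : MemH 4 f) (hg : MemH 4 g)
    (x : ℝ) :
    fourierDeriv k (fun y => f y - g y) x = fourierDeriv k f x - fourierDeriv k g x := by
  have hint : ∀ {h : Torus → ℝ}, MemH 4 h → Integrable (fun y : Torus => (h y : ℂ))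
      AddCircle.haarAddCircle := fun {h} hh =>
    (Complex.continuous_ofReal.comp hh.1).integrable_of_hasCompactSupport
      (HasCompactSupport.of_compactSpace _)
  have hc : ∀ m : ℤ, fourierCoeff (T := (1 : ℝ)) (fun y => ((f y - g y : ℝ) : ℂ)) m =
      fourierCoeff (T := (1 : ℝ)) (fun y => (f y : ℂ)) m -
        fourierCoeff (T := (1 : ℝ)) (fun y => (g y : ℂ)) m := by
    intro m
    have h1 := congrFun (fourierCoeff.add (hint hf) ((hint hg).neg)) m
    have h2 := fourierCoeff.const_mul (T := (1 : ℝ)) (fun y => (g y : ℂ)) (-1) m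
    have e1 : (fun y => ((f y - g y : ℝ) : ℂ)) =
        ((fun y => (f y : ℂ)) + -fun y : Torus => (g y : ℂ)) := by
      ext y; simp [sub_eq_add_neg]
    have e2 : (-fun y : Torus => (g y : ℂ)) = fun y => (-1 : ℂ) * (g y : ℂ) := by
      ext y; simp
    rw [e1, h1, Pi.add_apply, e2, h2]
    ring
  simp only [fourierDeriv]
  rw [← Complex.sub_re, ← (summable_fourierDeriv_term hk hf x).tsum_sub
    (summable_fourierDeriv_term hk hg x)]
  congr 1
  refine tsum_congr fun m => ?_
  rw [hc m]
  ring

theorem continuous_fourierDeriv {k : ℕ} (hk : k ≤ 2) {f : Torus → ℝ} (hf : MemH 4 f) :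
    Continuous (fourierDeriv k f) := by
  refine Complex.continuous_re.comp ?_
  refine continuous_tsum (fun m => ?_) (summable_fourierCoeff_weighted hf)
    fun m x => norm_fourierDeriv_term_le hk _ m x
  exact continuous_const.mul ((map_continuous (fourier m)).comp (AddCircle.continuous_mk' 1))

/-- A function in `C([0,T]; H⁴)` has jointly continuous spatial derivatives up to order two. -/
theorem continuousOn_fourierDeriv {k : ℕ} (hk : k ≤ 2) {T : ℝ} {f : ℝ → Torus → ℝ}
    (hf : ContH 4 T f) :
    ContinuousOn (fun z : ℝ × ℝ => fourierDeriv k (f z.1) z.2) (Icc 0 T ×ˢ univ) := by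
  rintro ⟨t, x⟩ ⟨ht, -⟩
  have ht' : t ∈ Icc 0 T := ht
  set A := ENNReal.ofReal ((2 * Real.pi) ^ 2) * embeddingConst
  have hA : A ≠ ∞ := ENNReal.mul_ne_top ENNReal.ofReal_ne_top embeddingConst_ne_top
  have h1 : Tendsto (fun z : ℝ × ℝ => fourierDeriv k (f t) z.2)
      (𝓝[Icc 0 T ×ˢ univ] (t, x)) (𝓝 (fourierDeriv k (f t) x)) :=
    (((continuous_fourierDeriv hk (hf.1 t ht')).comp continuous_snd).tendsto (t, x)).mono_left
      nhdsWithin_le_nhds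
  have h2 : Tendsto (fun z : ℝ × ℝ => A * hNorm 4 (fun y => f z.1 y - f t y))
      (𝓝[Icc 0 T ×ˢ univ] (t, x)) (𝓝 0) := by
    have h := ENNReal.Tendsto.const_mul (a := A) (hf.2 t ht') (Or.inr hA)
    rw [mul_zero] at h
    refine h.comp (f := Prod.fst) ?_
    refine tendsto_nhdsWithin_iff.2 ⟨(continuous_fst.tendsto (t, x)).mono_left
      nhdsWithin_le_nhds, ?_⟩
    filter_upwards [self_mem_nhdsWithin] with z hz using hz.1
  have h3 : Tendsto (fun z : ℝ × ℝ => fourierDeriv k (f z.1) z.2 - fourierDeriv k (f t) z.2)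
      (𝓝[Icc 0 T ×ˢ univ] (t, x)) (𝓝 0) := by
    rw [tendsto_zero_iff_enorm_tendsto_zero]
    refine tendsto_of_tendsto_of_tendsto_of_le_of_le' tendsto_const_nhds h2
      (Eventually.of_forall fun _ => bot_le) ?_
    filter_upwards [self_mem_nhdsWithin] with z hz
    rw [← fourierDeriv_sub hk (hf.1 _ hz.1) (hf.1 t ht')]
    exact enorm_fourierDeriv_le hk _ _
  simpa [ContinuousWithinAt] using h3.add h1

/-! ### Functions of time and space on a slab -/

theorem clamp_mem {T : ℝ} (hT : 0 ≤ T) (s : ℝ) : max 0 (min s T) ∈ Icc 0 T :=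
  ⟨le_max_left _ _, max_le hT (min_le_right _ _)⟩

theorem clamp_eq {T s : ℝ} (hs : s ∈ Icc 0 T) : max 0 (min s T) = s := by
  rw [min_eq_left hs.2, max_eq_right hs.1]

/-- Freezing the time outside `[0,T]` extends a continuous function on the slab to the plane. -/
theorem continuous_clamp {T : ℝ} (hT : 0 ≤ T) {g : ℝ → ℝ → ℝ}
    (hg : ContinuousOn (fun z : ℝ × ℝ => g z.1 z.2) (Icc 0 T ×ˢ univ)) :
    Continuous (fun z : ℝ × ℝ => g (max 0 (min z.1 T)) z.2) :=
  hg.comp_continuous (f := fun z : ℝ × ℝ => (max 0 (min z.1 T), z.2)) (by fun_prop)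
    fun z => ⟨clamp_mem hT z.1, mem_univ _⟩

theorem continuous_slice {T : ℝ} {g : ℝ → ℝ → ℝ}
    (hg : ContinuousOn (fun z : ℝ × ℝ => g z.1 z.2) (Icc 0 T ×ˢ univ)) {t : ℝ}
    (ht : t ∈ Icc 0 T) : Continuous (g t) :=
  hg.comp_continuous (f := fun x : ℝ => (t, x)) (by fun_prop) fun _ => ⟨ht, mem_univ _⟩

theorem eq_add_integral_clamp {T : ℝ} (hT : 0 ≤ T) {f g : ℝ → ℝ → ℝ}
    (hf : ∀ t ∈ Icc 0 T, ∀ x, HasDerivWithinAt (fun s => f s x) (g t x) (Icc 0 T) t)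
    (hg : ContinuousOn (fun z : ℝ × ℝ => g z.1 z.2) (Icc 0 T ×ˢ univ))
    {t : ℝ} (ht : t ∈ Icc 0 T) (x : ℝ) :
    f t x = f 0 x + ∫ s in (0 : ℝ)..t, g (max 0 (min s T)) x := by
  have hc := continuous_clamp hT hg
  have hcx : Continuous fun s => g (max 0 (min s T)) x :=
    hc.comp (continuous_id.prodMk continuous_const)
  have hsub : Icc 0 t ⊆ Icc 0 T := Icc_subset_Icc_right ht.2
  have h := intervalIntegral.integral_eq_sub_of_hasDerivAt_of_le ht.1 (f := fun s => f s x)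
    (f' := fun s => g (max 0 (min s T)) x)
    (fun s hs => ((hf s (hsub hs) x).continuousWithinAt).mono hsub)
    (fun s hs => by
      have hs' : s ∈ Icc 0 T := hsub (Ioo_subset_Icc_self hs)
      rw [clamp_eq hs']
      exact (hf s hs' x).hasDerivAt (Icc_mem_nhds hs.1 (hs.2.trans_le ht.2)))
    (hcx.intervalIntegrable _ _)
  rw [h]; ring

theorem integral_integral_swap_of_continuous {g : ℝ → ℝ → ℝ}
    (hg : Continuous fun z : ℝ × ℝ => g z.1 z.2) (a b c d : ℝ) :
    ∫ x in a..b, ∫ y in c..d, g x y = ∫ y in c..d, ∫ x in a..b, g x y := by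
  refine intervalIntegral_intervalIntegral_swap ?_
  refine (ContinuousOn.integrableOn_compact (isCompact_uIcc.prod isCompact_uIcc)
    hg.continuousOn).mono_set (prod_mono uIoc_subset_uIcc uIoc_subset_uIcc)

/-- A space integral whose time derivative is nonpositive does not exceed its initial value. -/
theorem integral_le_integral_zero {T : ℝ} (hT : 0 ≤ T) {f g : ℝ → ℝ → ℝ}
    (hf : ∀ t ∈ Icc 0 T, ∀ x, HasDerivWithinAt (fun s => f s x) (g t x) (Icc 0 T) t)
    (hfc : ContinuousOn (fun z : ℝ × ℝ => f z.1 z.2) (Icc 0 T ×ˢ univ))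
    (hg : ContinuousOn (fun z : ℝ × ℝ => g z.1 z.2) (Icc 0 T ×ˢ univ))
    (hneg : ∀ t ∈ Icc 0 T, ∫ x in (0 : ℝ)..1, g t x ≤ 0) {t : ℝ} (ht : t ∈ Icc 0 T) :
    ∫ x in (0 : ℝ)..1, f t x ≤ ∫ x in (0 : ℝ)..1, f 0 x := by
  have hc := continuous_clamp hT hg
  have h0 : (0 : ℝ) ∈ Icc 0 T := ⟨le_rfl, hT⟩
  have hi : Continuous fun x => ∫ s in (0 : ℝ)..t, g (max 0 (min s T)) x :=
    intervalIntegral.continuous_parametric_intervalIntegral_of_continuous'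
      (f := fun x s => g (max 0 (min s T)) x) (hc.comp continuous_swap) _ _
  simp_rw [eq_add_integral_clamp hT hf hg ht]
  rw [intervalIntegral.integral_add ((continuous_slice hfc h0).intervalIntegrable _ _)
    (hi.intervalIntegrable _ _), ← integral_integral_swap_of_continuous hc]
  have : ∫ s in (0 : ℝ)..t, ∫ x in (0 : ℝ)..1, g (max 0 (min s T)) x ≤ 0 := by
    rw [← neg_nonneg, ← intervalIntegral.integral_neg]
    exact intervalIntegral.integral_nonneg ht.1
      fun s _ => neg_nonneg.2 (hneg _ (clamp_mem hT s))
  linarith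

/-- Exchange of the derivatives in time and in space. -/
theorem hasDerivWithinAt_swap {T : ℝ} (hT : 0 ≤ T) {f f₁ g g₁ : ℝ → ℝ → ℝ}
    (hf : ∀ t ∈ Icc 0 T, ∀ x, HasDerivWithinAt (fun s => f s x) (g t x) (Icc 0 T) t)
    (hfx : ∀ t ∈ Icc 0 T, ∀ x, HasDerivAt (f t) (f₁ t x) x)
    (hgx : ∀ t ∈ Icc 0 T, ∀ x, HasDerivAt (g t) (g₁ t x) x)
    (hg : ContinuousOn (fun z : ℝ × ℝ => g z.1 z.2) (Icc 0 T ×ˢ univ))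
    (hg₁ : ContinuousOn (fun z : ℝ × ℝ => g₁ z.1 z.2) (Icc 0 T ×ˢ univ))
    {t : ℝ} (ht : t ∈ Icc 0 T) (x : ℝ) :
    HasDerivWithinAt (fun s => f₁ s x) (g₁ t x) (Icc 0 T) t := by
  have hc := continuous_clamp hT hg
  have hc₁ := continuous_clamp hT hg₁
  have h0 : (0 : ℝ) ∈ Icc 0 T := ⟨le_rfl, hT⟩
  have key : ∀ s ∈ Icc 0 T, f₁ s x = f₁ 0 x + ∫ r in (0 : ℝ)..s, g₁ (max 0 (min r T)) x := by
    intro s hs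
    have hi : Continuous fun y => ∫ r in (0 : ℝ)..s, g₁ (max 0 (min r T)) y :=
      intervalIntegral.continuous_parametric_intervalIntegral_of_continuous'
        (f := fun y r => g₁ (max 0 (min r T)) y) (hc₁.comp continuous_swap) _ _
    have hprim : ∀ y, f s y = f s 0 + (f 0 y - f 0 0) +
        ∫ z in (0 : ℝ)..y, ∫ r in (0 : ℝ)..s, g₁ (max 0 (min r T)) z := by
      intro y
      rw [← integral_integral_swap_of_continuous hc₁]
      have hin : ∀ r, ∫ z in (0 : ℝ)..y, g₁ (max 0 (min r T)) z =
          g (max 0 (min r T)) y - g (max 0 (min r T)) 0 := fun r =>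
        intervalIntegral.integral_eq_sub_of_hasDerivAt
          (fun z _ => hgx _ (clamp_mem hT r) z)
          ((continuous_slice hg₁ (clamp_mem hT r)).intervalIntegrable _ _)
      simp_rw [hin]
      have hs' : ∀ y, Continuous fun r => g (max 0 (min r T)) y := fun y =>
        hc.comp (continuous_id.prodMk continuous_const)
      rw [intervalIntegral.integral_sub ((hs' y).intervalIntegrable _ _)
        ((hs' 0).intervalIntegrable _ _)]
      linarith [eq_add_integral_clamp hT hf hg hs y, eq_add_integral_clamp hT hf hg hs 0]
    have hd : HasDerivAt (f s) (f₁ 0 x + ∫ r in (0 : ℝ)..s, g₁ (max 0 (min r T)) x) x := by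
      have h1 := ((hfx 0 h0 x).sub_const (f 0 0)).const_add (f s 0)
      have h2 := h1.add (hi.integral_hasStrictDerivAt 0 x).hasDerivAt
      exact h2.congr_of_eventuallyEq (Eventually.of_forall hprim)
    exact (hfx s hs x).unique hd
  have hcx : Continuous fun r => g₁ (max 0 (min r T)) x :=
    hc₁.comp (continuous_id.prodMk continuous_const)
  have hd := ((hcx.integral_hasStrictDerivAt 0 t).hasDerivAt.const_add (f₁ 0 x)).hasDerivWithinAt
    (s := Icc 0 T)
  rw [clamp_eq ht] at hd
  exact hd.congr key (key t ht)

theorem deriv_nonpos_of_isMinOn {T d t : ℝ} {f : ℝ → ℝ} (hf : HasDerivWithinAt f d (Icc 0 T) t)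
    (ht : t ∈ Icc 0 T) (ht0 : t ≠ 0) (hmin : IsMinOn f (Icc 0 T) t) : d ≤ 0 := by
  have ht0' : 0 < t := lt_of_le_of_ne ht.1 (Ne.symm ht0)
  have hseg : segment ℝ t 0 ⊆ Icc 0 T :=
    (convex_Icc 0 T).segment_subset ht ⟨le_rfl, ht.1.trans ht.2⟩
  have h := IsLocalMinOn.hasFDerivWithinAt_nonneg hmin.localize hf.hasFDerivWithinAt
    (sub_mem_posTangentConeAt_of_segment_subset hseg)
  simp at h
  nlinarith

theorem exists_forall_abs_le_of_periodic {T : ℝ} {g : ℝ → ℝ → ℝ}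
    (hg : ContinuousOn (fun z : ℝ × ℝ => g z.1 z.2) (Icc 0 T ×ˢ univ)) :
    ∃ L, ∀ t ∈ Icc 0 T, ∀ x ∈ Icc (0 : ℝ) 1, |g t x| ≤ L := by
  have hQ : IsCompact (Icc 0 T ×ˢ Icc (0 : ℝ) 1) := isCompact_Icc.prod isCompact_Icc
  obtain ⟨L, hL⟩ := hQ.exists_bound_of_continuousOn (hg.mono (prod_mono le_rfl (subset_univ _)))
  exact ⟨L, fun t ht x hx => hL (t, x) ⟨ht, hx⟩⟩

/-- Minimum principle for the continuity equation: a density that is positive at time `0` stays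
positive. -/
theorem pos_of_continuity_eq {T : ℝ} (hT : 0 ≤ T) {ρ ρ₁ u u₁ : ℝ → ℝ → ℝ}
    (hper : ∀ t x, ρ t (x + 1) = ρ t x)
    (hρc : ContinuousOn (fun z : ℝ × ℝ => ρ z.1 z.2) (Icc 0 T ×ˢ univ))
    (hu₁ : ContinuousOn (fun z : ℝ × ℝ => u₁ z.1 z.2) (Icc 0 T ×ˢ univ))
    (hρx : ∀ t ∈ Icc 0 T, ∀ x, HasDerivAt (ρ t) (ρ₁ t x) x)
    (hρt : ∀ t ∈ Icc 0 T, ∀ x, HasDerivWithinAt (fun s => ρ s x)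
      (-(ρ₁ t x * u t x + ρ t x * u₁ t x)) (Icc 0 T) t)
    (h0 : ∀ x, 0 < ρ 0 x) : ∀ t ∈ Icc 0 T, ∀ x, 0 < ρ t x := by
  have h0T : (0 : ℝ) ∈ Icc 0 T := ⟨le_rfl, hT⟩
  obtain ⟨L, hL⟩ := exists_forall_abs_le_of_periodic hu₁
  obtain ⟨y, hy, hymin⟩ := isCompact_Icc.exists_isMinOn (nonempty_Icc.2 zero_le_one)
    (continuous_slice hρc h0T).continuousOn (s := Icc (0 : ℝ) 1)
  set ε := ρ 0 y / 2
  have hε : 0 < ε := half_pos (h0 y)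
  set K := L + 1
  have hK : ∀ t ∈ Icc 0 T, ∀ x ∈ Icc (0 : ℝ) 1, 0 < K + u₁ t x ∧ 0 < K - u₁ t x := by
    intro t ht x hx
    have := abs_le.1 (hL t ht x hx)
    constructor <;> simp only [K] <;> linarith
  -- `ε exp (-K t)` is a strict subsolution; the factor `exp (-K t)` in front makes the zeroth
  -- order term coercive, so that a negative minimum contradicts the equation.
  let f : ℝ → ℝ → ℝ := fun t x => Real.exp (-K * t) * (ρ t x - ε * Real.exp (-K * t))
  have hfc : ContinuousOn (fun z : ℝ × ℝ => f z.1 z.2) (Icc 0 T ×ˢ Icc (0 : ℝ) 1) := by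
    have := hρc.mono (prod_mono (le_refl (Icc 0 T)) (subset_univ (Icc (0 : ℝ) 1)))
    fun_prop
  obtain ⟨⟨t₀, x₀⟩, ⟨ht₀, hx₀⟩, hmin⟩ := (isCompact_Icc.prod isCompact_Icc).exists_isMinOn
    ⟨((0 : ℝ), (0 : ℝ)), ⟨h0T, ⟨le_rfl, zero_le_one⟩⟩⟩ hfc
  simp only at ht₀ hx₀
  have hfper : ∀ t, Function.Periodic (f t) 1 := fun t x => by simp only [f, hper]
  have hmin' : ∀ t ∈ Icc 0 T, ∀ x, f t₀ x₀ ≤ f t x := by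
    intro t ht x
    obtain ⟨x', hx', hxx'⟩ := (hfper t).exists_mem_Ico₀ zero_lt_one x
    rw [hxx']
    exact hmin (show (t, x') ∈ Icc 0 T ×ˢ Icc (0 : ℝ) 1 from ⟨ht, Ico_subset_Icc_self hx'⟩)
  have hnonneg : 0 ≤ f t₀ x₀ := by
    by_contra! hlt
    have he := Real.exp_pos (-K * t₀)
    have hlt' : ρ t₀ x₀ < ε * Real.exp (-K * t₀) := by
      by_contra! h
      exact absurd hlt (not_lt.2 (mul_nonneg he.le (sub_nonneg.2 h)))
    have ht0 : t₀ ≠ 0 := by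
      rintro rfl
      have h1 : ρ 0 y ≤ ρ 0 x₀ := hymin hx₀
      have h2 : ρ 0 y = 2 * ε := by simp only [ε]; ring
      simp at hlt'
      linarith
    have hρ₁ : ρ₁ t₀ x₀ = 0 := by
      have hloc : IsLocalMin (ρ t₀) x₀ := Eventually.of_forall fun x => by
        have := le_of_mul_le_mul_left (hmin' t₀ ht₀ x) he
        linarith
      exact hloc.hasDerivAt_eq_zero (hρx t₀ ht₀ x₀)
    have hexp : HasDerivAt (fun s => Real.exp (-K * s)) (Real.exp (-K * t₀) * -K) t₀ := by
      simpa using ((hasDerivAt_id t₀).const_mul (-K)).exp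
    have hd := hexp.hasDerivWithinAt (s := Icc 0 T) |>.mul
      ((hρt t₀ ht₀ x₀).sub (hexp.hasDerivWithinAt.const_mul ε))
    have hle := deriv_nonpos_of_isMinOn hd ht₀ ht0 fun s hs => hmin' s hs x₀
    rw [hρ₁] at hle
    obtain ⟨k1, k2⟩ := hK t₀ ht₀ x₀ hx₀
    set e := Real.exp (-K * t₀)
    have hpos : 0 < e * ((K + u₁ t₀ x₀) * (ε * e - ρ t₀ x₀) + (K - u₁ t₀ x₀) * (ε * e)) := by
      have := sub_pos.2 hlt'
      positivity
    simp only [Pi.sub_apply] at hle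
    linarith [hle, hpos]
  intro t ht x
  have h := hnonneg.trans (hmin' t ht x)
  have he := Real.exp_pos (-K * t)
  have := nonneg_of_mul_nonneg_right h he
  have : 0 < ε * Real.exp (-K * t) := by positivity
  linarith

/-! ### Conservation of mass and the two energy inequalities -/

/-- A field on `[0,T] × ℝ`, of period one in space, together with its first two spatial derivatives,
all of them jointly continuous. -/
structure IsPeriodicC2 (T : ℝ) (f f₁ f₂ : ℝ → ℝ → ℝ) : Prop where
  periodic : ∀ t x, f t (x + 1) = f t x
  periodic₁ : ∀ t x, f₁ t (x + 1) = f₁ t x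
  hasDerivAt : ∀ t ∈ Icc 0 T, ∀ x, HasDerivAt (f t) (f₁ t x) x
  hasDerivAt₁ : ∀ t ∈ Icc 0 T, ∀ x, HasDerivAt (f₁ t) (f₂ t x) x
  cont : ContinuousOn (fun z : ℝ × ℝ => f z.1 z.2) (Icc 0 T ×ˢ univ)
  cont₁ : ContinuousOn (fun z : ℝ × ℝ => f₁ z.1 z.2) (Icc 0 T ×ˢ univ)
  cont₂ : ContinuousOn (fun z : ℝ × ℝ => f₂ z.1 z.2) (Icc 0 T ×ˢ univ)

/-- A positive solution of the system on the line, of period one in space, with the spatial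
derivatives in the equations expanded. -/
structure IsPeriodicSolution (γ T : ℝ) (ρ ρ₁ ρ₂ u u₁ u₂ : ℝ → ℝ → ℝ) : Prop where
  fieldρ : IsPeriodicC2 T ρ ρ₁ ρ₂
  fieldu : IsPeriodicC2 T u u₁ u₂
  pos : ∀ t ∈ Icc 0 T, ∀ x, 0 < ρ t x
  continuity_eq : ∀ t ∈ Icc 0 T, ∀ x, HasDerivWithinAt (fun s => ρ s x)
    (-(ρ₁ t x * u t x + ρ t x * u₁ t x)) (Icc 0 T) t
  momentum_eq : ∀ t ∈ Icc 0 T, ∀ x, HasDerivWithinAt (fun s => ρ s x * u s x)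
    (-(ρ₁ t x * u t x ^ 2 + ρ t x * (2 * u t x * u₁ t x)) +
      (γ * ((γ + 1) * ρ t x ^ γ * ρ₁ t x) * u₁ t x + γ * ρ t x ^ (γ + 1) * u₂ t x)) (Icc 0 T) t

/-- The gradient `∂ₓ π(ρ) = γ ρ^γ ∂ₓ ρ` of the potential, which is also `ρ ∂ₓ p(ρ)`. -/
noncomputable def potentialGrad (γ : ℝ) (ρ ρ₁ : ℝ → ℝ → ℝ) (t x : ℝ) : ℝ :=
  γ * ρ t x ^ γ * ρ₁ t x

/-- The momentum `ρ w = ρ u + ∂ₓ π(ρ)` of the desired velocity. -/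
noncomputable def desiredMomentum (γ : ℝ) (ρ ρ₁ u : ℝ → ℝ → ℝ) (t x : ℝ) : ℝ :=
  ρ t x * u t x + potentialGrad γ ρ ρ₁ t x

theorem integral_deriv_eq_zero_of_periodic {Φ Φ₁ : ℝ → ℝ} (h : ∀ x, HasDerivAt Φ (Φ₁ x) x)
    (hc : Continuous Φ₁) (hper : Φ 1 = Φ 0) : ∫ x in (0 : ℝ)..1, Φ₁ x = 0 := by
  rw [intervalIntegral.integral_eq_sub_of_hasDerivAt (fun x _ => h x) (hc.intervalIntegrable _ _),
    hper, sub_self]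

theorem IsPeriodicC2.periodic_one {T : ℝ} {f f₁ f₂ : ℝ → ℝ → ℝ} (h : IsPeriodicC2 T f f₁ f₂)
    (t : ℝ) : f t 1 = f t 0 := by
  simpa using h.periodic t 0

theorem IsPeriodicC2.periodic₁_one {T : ℝ} {f f₁ f₂ : ℝ → ℝ → ℝ} (h : IsPeriodicC2 T f f₁ f₂)
    (t : ℝ) : f₁ t 1 = f₁ t 0 := by
  simpa using h.periodic₁ t 0

namespace IsPeriodicSolution

variable {γ T : ℝ} {ρ ρ₁ ρ₂ u u₁ u₂ : ℝ → ℝ → ℝ}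

theorem continuousOn_rpow (S : IsPeriodicSolution γ T ρ ρ₁ ρ₂ u u₁ u₂) (a : ℝ) :
    ContinuousOn (fun z : ℝ × ℝ => ρ z.1 z.2 ^ a) (Icc 0 T ×ˢ univ) :=
  S.fieldρ.cont.rpow_const fun z hz => Or.inl (S.pos z.1 hz.1 z.2).ne'

theorem hasDerivAt_rpow (S : IsPeriodicSolution γ T ρ ρ₁ ρ₂ u u₁ u₂) (a : ℝ) {t : ℝ}
    (ht : t ∈ Icc 0 T) (x : ℝ) :
    HasDerivAt (fun y => ρ t y ^ a) (a * ρ t x ^ (a - 1) * ρ₁ t x) x :=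
  ((S.fieldρ.hasDerivAt t ht x).rpow_const (Or.inl (S.pos t ht x).ne')).congr_deriv (by ring)

theorem integral_density_le (S : IsPeriodicSolution γ T ρ ρ₁ ρ₂ u u₁ u₂) (hT : 0 ≤ T) {t : ℝ}
    (ht : t ∈ Icc 0 T) : ∫ x in (0 : ℝ)..1, ρ t x ≤ ∫ x in (0 : ℝ)..1, ρ 0 x := by
  have c0 := S.fieldρ.cont
  have c1 := S.fieldρ.cont₁
  have d0 := S.fieldu.cont
  have d1 := S.fieldu.cont₁
  let g : ℝ → ℝ → ℝ := fun t x => -(ρ₁ t x * u t x + ρ t x * u₁ t x)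
  have hg : ContinuousOn (fun z : ℝ × ℝ => g z.1 z.2) (Icc 0 T ×ˢ univ) := by
    simp only [g]; fun_prop
  refine integral_le_integral_zero hT S.continuity_eq c0 hg (fun s hs => ?_) ht
  refine (integral_deriv_eq_zero_of_periodic (Φ := fun x => -(ρ s x * u s x)) (fun x =>
    ((S.fieldρ.hasDerivAt s hs x).mul (S.fieldu.hasDerivAt s hs x)).neg)
    (continuous_slice hg hs) ?_).le
  simp only [S.fieldρ.periodic_one, S.fieldu.periodic_one]

/-- Dissipation of the kinetic energy `∫ ρ u²`. -/
theorem integral_energy_le (S : IsPeriodicSolution γ T ρ ρ₁ ρ₂ u u₁ u₂) (hγ : 0 ≤ γ)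
    (hT : 0 ≤ T) {t : ℝ} (ht : t ∈ Icc 0 T) :
    ∫ x in (0 : ℝ)..1, (ρ t x * u t x) ^ 2 / ρ t x ≤
      ∫ x in (0 : ℝ)..1, (ρ 0 x * u 0 x) ^ 2 / ρ 0 x := by
  have c0 := S.fieldρ.cont
  have c1 := S.fieldρ.cont₁
  have d0 := S.fieldu.cont
  have d1 := S.fieldu.cont₁
  have d2 := S.fieldu.cont₂
  have r0 := S.continuousOn_rpow γ
  have r1 := S.continuousOn_rpow (γ + 1)
  let Λ : ℝ → ℝ → ℝ := fun t x =>
    γ * ((γ + 1) * ρ t x ^ γ * ρ₁ t x) * u₁ t x + γ * ρ t x ^ (γ + 1) * u₂ t x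
  let g : ℝ → ℝ → ℝ := fun t x =>
    2 * u t x * (-(ρ₁ t x * u t x ^ 2 + ρ t x * (2 * u t x * u₁ t x)) + Λ t x) +
      u t x ^ 2 * (ρ₁ t x * u t x + ρ t x * u₁ t x)
  have hg : ContinuousOn (fun z : ℝ × ℝ => g z.1 z.2) (Icc 0 T ×ˢ univ) := by
    simp only [g, Λ]; fun_prop
  refine integral_le_integral_zero (f := fun t x => (ρ t x * u t x) ^ 2 / ρ t x) (g := g) hT
    (fun s hs x => ?_) (((c0.mul d0).pow 2).div c0 fun z hz => (S.pos z.1 hz.1 z.2).ne') hg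
    (fun s hs => ?_) ht
  · have hp := (S.pos s hs x).ne'
    refine (((S.momentum_eq s hs x).pow 2).div (S.continuity_eq s hs x) hp).congr_deriv ?_
    simp only [g, Λ, Pi.pow_apply]
    field_simp
    push_cast
    ring
  · -- `g` is the derivative of the flux `-ρ u³ + 2 u λ ∂ₓ u` minus the dissipation `2 λ (∂ₓ u)²`.
    let Φ₁ : ℝ → ℝ := fun x => g s x + 2 * (γ * ρ s x ^ (γ + 1) * u₁ s x ^ 2)
    have hdis : Continuous fun x => 2 * (γ * ρ s x ^ (γ + 1) * u₁ s x ^ 2) :=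
      continuous_slice (g := fun t x => 2 * (γ * ρ t x ^ (γ + 1) * u₁ t x ^ 2)) (by fun_prop) hs
    have hΦ : ∫ x in (0 : ℝ)..1, Φ₁ x = 0 := by
      refine integral_deriv_eq_zero_of_periodic
        (Φ := fun x => -(ρ s x * u s x ^ 3) + 2 * u s x * (γ * ρ s x ^ (γ + 1) * u₁ s x))
        (fun x => ?_) ((continuous_slice hg hs).add hdis) ?_
      · have hr := S.fieldρ.hasDerivAt s hs x
        have hu := S.fieldu.hasDerivAt s hs x
        have hl := ((S.hasDerivAt_rpow (γ + 1) hs x).const_mul γ).mul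
          (S.fieldu.hasDerivAt₁ s hs x)
        refine ((hr.mul (hu.pow 3)).neg.add ((hu.const_mul 2).mul hl)).congr_deriv ?_
        simp only [Φ₁, g, Λ, add_sub_cancel_right, Pi.pow_apply, Pi.mul_apply]
        push_cast
        ring
      · simp only [S.fieldρ.periodic_one, S.fieldu.periodic_one, S.fieldu.periodic₁_one]
    simp only [Φ₁] at hΦ
    rw [intervalIntegral.integral_add ((continuous_slice hg hs).intervalIntegrable _ _)
      (hdis.intervalIntegrable _ _)] at hΦ
    have : 0 ≤ ∫ x in (0 : ℝ)..1, 2 * (γ * ρ s x ^ (γ + 1) * u₁ s x ^ 2) :=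
      intervalIntegral.integral_nonneg zero_le_one fun x _ => by
        have := Real.rpow_nonneg (S.pos s hs x).le (γ + 1)
        positivity
    linarith

/-- The spatial derivative of `desiredMomentum`. -/
noncomputable def desiredMomentumGrad (γ : ℝ) (ρ ρ₁ ρ₂ u u₁ : ℝ → ℝ → ℝ) (t x : ℝ) : ℝ :=
  ρ₁ t x * u t x + ρ t x * u₁ t x +
    γ * (γ * ρ t x ^ (γ - 1) * ρ₁ t x ^ 2 + ρ t x ^ γ * ρ₂ t x)

theorem hasDerivAt_desiredMomentum (S : IsPeriodicSolution γ T ρ ρ₁ ρ₂ u u₁ u₂) {t : ℝ}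
    (ht : t ∈ Icc 0 T) (x : ℝ) :
    HasDerivAt (desiredMomentum γ ρ ρ₁ u t) (desiredMomentumGrad γ ρ ρ₁ ρ₂ u u₁ t x) x := by
  have hr := S.fieldρ.hasDerivAt t ht x
  have hr₁ := S.fieldρ.hasDerivAt₁ t ht x
  have hu := S.fieldu.hasDerivAt t ht x
  refine ((hr.mul hu).add (((S.hasDerivAt_rpow γ ht x).const_mul γ).mul hr₁)).congr_deriv ?_
  simp only [desiredMomentumGrad]
  ring

theorem hasDerivAt_potential (S : IsPeriodicSolution γ T ρ ρ₁ ρ₂ u u₁ u₂) (hγ : 0 ≤ γ) {t : ℝ}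
    (ht : t ∈ Icc 0 T) (x : ℝ) :
    HasDerivAt (fun y => potential γ (ρ t y)) (potentialGrad γ ρ ρ₁ t x) x := by
  refine ((S.hasDerivAt_rpow (γ + 1) ht x).const_mul (γ / (γ + 1))).congr_deriv ?_
  rw [add_sub_cancel_right, potentialGrad]
  field_simp

/-- `ρ w` is transported by `u`. The diffusion in the momentum equation is exactly cancelled by
the evolution of `∂ₓ π(ρ)`. -/
theorem desiredMomentum_eq (S : IsPeriodicSolution γ T ρ ρ₁ ρ₂ u u₁ u₂) (hγ : 0 ≤ γ)
    (hT : 0 ≤ T) {t : ℝ} (ht : t ∈ Icc 0 T) (x : ℝ) :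
    HasDerivWithinAt (fun s => desiredMomentum γ ρ ρ₁ u s x)
      (-(u₁ t x * desiredMomentum γ ρ ρ₁ u t x +
        u t x * desiredMomentumGrad γ ρ ρ₁ ρ₂ u u₁ t x)) (Icc 0 T) t := by
  have c0 := S.fieldρ.cont
  have c1 := S.fieldρ.cont₁
  have c2 := S.fieldρ.cont₂
  have d0 := S.fieldu.cont
  have d1 := S.fieldu.cont₁
  have d2 := S.fieldu.cont₂
  have r0 := S.continuousOn_rpow γ
  have r1 := S.continuousOn_rpow (γ - 1)
  have hπ := hasDerivWithinAt_swap hT (f := fun t x => potential γ (ρ t x))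
    (f₁ := potentialGrad γ ρ ρ₁)
    (g := fun t x => γ * ρ t x ^ γ * (-(ρ₁ t x * u t x + ρ t x * u₁ t x)))
    (g₁ := fun t x => γ * (γ * ρ t x ^ (γ - 1) * ρ₁ t x) * (-(ρ₁ t x * u t x + ρ t x * u₁ t x)) +
      γ * ρ t x ^ γ * (-(ρ₂ t x * u t x + 2 * (ρ₁ t x * u₁ t x) + ρ t x * u₂ t x)))
    (fun s hs y => by
      refine ((((S.continuity_eq s hs y).rpow_const (p := γ + 1)
        (Or.inl (S.pos s hs y).ne')).const_mul (γ / (γ + 1)))).congr_deriv ?_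
      rw [add_sub_cancel_right]
      field_simp)
    (fun s hs y => S.hasDerivAt_potential hγ hs y)
    (fun s hs y => by
      have hr := S.fieldρ.hasDerivAt s hs y
      have hr₁ := S.fieldρ.hasDerivAt₁ s hs y
      have hu := S.fieldu.hasDerivAt s hs y
      have hu₁ := S.fieldu.hasDerivAt₁ s hs y
      refine (((S.hasDerivAt_rpow γ hs y).const_mul γ).mul
        (((hr₁.mul hu).add (hr.mul hu₁)).neg)).congr_deriv ?_
      simp only [Pi.neg_apply, Pi.add_apply, Pi.mul_apply]
      ring)
    (by fun_prop) (by fun_prop) ht x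
  refine ((S.momentum_eq t ht x).add hπ).congr_deriv ?_
  have hp := S.pos t ht x
  have e0 : ρ t x ^ γ = ρ t x ^ (γ - 1) * ρ t x := by
    rw [← Real.rpow_add_one hp.ne', sub_add_cancel]
  rw [Real.rpow_add_one hp.ne']
  simp only [desiredMomentum, potentialGrad, desiredMomentumGrad, e0]
  ring

/-- Conservation of `∫ ρ w²`, as an inequality. -/
theorem integral_desired_energy_le (S : IsPeriodicSolution γ T ρ ρ₁ ρ₂ u u₁ u₂) (hγ : 0 ≤ γ)
    (hT : 0 ≤ T) {t : ℝ} (ht : t ∈ Icc 0 T) :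
    ∫ x in (0 : ℝ)..1, desiredMomentum γ ρ ρ₁ u t x ^ 2 / ρ t x ≤
      ∫ x in (0 : ℝ)..1, desiredMomentum γ ρ ρ₁ u 0 x ^ 2 / ρ 0 x := by
  have c0 := S.fieldρ.cont
  have c1 := S.fieldρ.cont₁
  have c2 := S.fieldρ.cont₂
  have d0 := S.fieldu.cont
  have d1 := S.fieldu.cont₁
  have r0 := S.continuousOn_rpow γ
  have r1 := S.continuousOn_rpow (γ - 1)
  have hq : ContinuousOn (fun z : ℝ × ℝ => desiredMomentum γ ρ ρ₁ u z.1 z.2)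
      (Icc 0 T ×ˢ univ) := by
    simp only [desiredMomentum, potentialGrad]; fun_prop
  have hq₁ : ContinuousOn (fun z : ℝ × ℝ => desiredMomentumGrad γ ρ ρ₁ ρ₂ u u₁ z.1 z.2)
      (Icc 0 T ×ˢ univ) := by
    simp only [desiredMomentumGrad]; fun_prop
  have hne : ∀ z ∈ Icc 0 T ×ˢ (univ : Set ℝ), ρ z.1 z.2 ≠ 0 := fun z hz =>
    (S.pos z.1 hz.1 z.2).ne'
  let w : ℝ → ℝ → ℝ := fun t x => desiredMomentum γ ρ ρ₁ u t x / ρ t x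
  have hw : ContinuousOn (fun z : ℝ × ℝ => w z.1 z.2) (Icc 0 T ×ˢ univ) := hq.div c0 hne
  let g : ℝ → ℝ → ℝ := fun t x =>
    2 * w t x * (-(u₁ t x * desiredMomentum γ ρ ρ₁ u t x +
        u t x * desiredMomentumGrad γ ρ ρ₁ ρ₂ u u₁ t x)) +
      w t x ^ 2 * (ρ₁ t x * u t x + ρ t x * u₁ t x)
  have hg : ContinuousOn (fun z : ℝ × ℝ => g z.1 z.2) (Icc 0 T ×ˢ univ) := by
    simp only [g]; fun_prop
  refine integral_le_integral_zero (f := fun t x => desiredMomentum γ ρ ρ₁ u t x ^ 2 / ρ t x)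
    (g := g) hT (fun s hs x => ?_) ((hq.pow 2).div c0 hne) hg (fun s hs => ?_) ht
  · have hp := (S.pos s hs x).ne'
    refine (((S.desiredMomentum_eq hγ hT hs x).pow 2).div (S.continuity_eq s hs x) hp).congr_deriv ?_
    simp only [g, w, Pi.pow_apply]
    field_simp
    push_cast
    ring
  · -- `g` is the derivative of the flux `-ρ u w²`.
    refine (integral_deriv_eq_zero_of_periodic
      (Φ := fun x => -(u s x * (desiredMomentum γ ρ ρ₁ u s x ^ 2 / ρ s x)))
      (fun x => ?_) (continuous_slice hg hs) ?_).le
    · have hp := (S.pos s hs x).ne'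
      have hr := S.fieldρ.hasDerivAt s hs x
      have hu := S.fieldu.hasDerivAt s hs x
      refine (hu.mul (((S.hasDerivAt_desiredMomentum hs x).pow 2).div hr hp)).neg.congr_deriv ?_
      simp only [g, w, Pi.pow_apply, Pi.div_apply]
      field_simp
      push_cast
      ring
    · simp only [desiredMomentum, potentialGrad, S.fieldρ.periodic_one, S.fieldu.periodic_one,
        S.fieldρ.periodic₁_one]

end IsPeriodicSolution

/-! ### Bounds on the potential -/

/-- A bound on the potential bounds the density, uniformly for `γ` away from zero. -/
theorem le_of_potential_le {γ r B : ℝ} (hγ : 0 < γ) (hB : 1 ≤ B) (h : potential γ r ≤ B) :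
    r ≤ (1 + γ⁻¹) * B := by
  have hpow : r ^ (γ + 1) ≤ (1 + γ⁻¹) * B := by
    calc r ^ (γ + 1) = (1 + γ⁻¹) * potential γ r := by
          unfold potential; field_simp
      _ ≤ _ := by gcongr
  by_contra! hlt
  have h1 : 1 ≤ (1 + γ⁻¹) * B := by nlinarith [inv_pos.2 hγ]
  have h2 : r ≤ r ^ (γ + 1) := by
    conv_lhs => rw [← Real.rpow_one r]
    exact Real.rpow_le_rpow_of_exponent_le (h1.trans hlt.le) (by linarith)
  linarith

namespace IsPeriodicSolution

variable {γ T D : ℝ} {ρ ρ₁ ρ₂ u u₁ u₂ : ℝ → ℝ → ℝ}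

theorem continuousOn_potentialGrad (S : IsPeriodicSolution γ T ρ ρ₁ ρ₂ u u₁ u₂) :
    ContinuousOn (fun z : ℝ × ℝ => potentialGrad γ ρ ρ₁ z.1 z.2) (Icc 0 T ×ˢ univ) := by
  have c1 := S.fieldρ.cont₁
  have r0 := S.continuousOn_rpow γ
  simp only [potentialGrad]; fun_prop

/-- `(∂ₓ π(ρ))² / ρ = ρ (w - u)²`, so the two energies control its integral. -/
theorem integral_sq_potentialGrad_div_le (S : IsPeriodicSolution γ T ρ ρ₁ ρ₂ u u₁ u₂)
    (hγ : 0 ≤ γ) (hT : 0 ≤ T)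
    (hu : ∫ x in (0 : ℝ)..1, (ρ 0 x * u 0 x) ^ 2 / ρ 0 x ≤ D)
    (hw : ∫ x in (0 : ℝ)..1, desiredMomentum γ ρ ρ₁ u 0 x ^ 2 / ρ 0 x ≤ D)
    {t : ℝ} (ht : t ∈ Icc 0 T) :
    ∫ x in (0 : ℝ)..1, potentialGrad γ ρ ρ₁ t x ^ 2 / ρ t x ≤ 4 * D := by
  have hu' := (S.integral_energy_le hγ hT ht).trans hu
  have hw' := (S.integral_desired_energy_le hγ hT ht).trans hw
  have cρ := continuous_slice S.fieldρ.cont ht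
  have cu := continuous_slice S.fieldu.cont ht
  have cπ := continuous_slice S.continuousOn_potentialGrad ht
  have hne : ∀ x, ρ t x ≠ 0 := fun x => (S.pos t ht x).ne'
  have cq : Continuous (desiredMomentum γ ρ ρ₁ u t) := (cρ.mul cu).add cπ
  have i1 : Continuous fun x => (ρ t x * u t x) ^ 2 / ρ t x := ((cρ.mul cu).pow 2).div cρ hne
  have i2 : Continuous fun x => desiredMomentum γ ρ ρ₁ u t x ^ 2 / ρ t x := (cq.pow 2).div cρ hne
  have i3 : Continuous fun x => potentialGrad γ ρ ρ₁ t x ^ 2 / ρ t x := (cπ.pow 2).div cρ hne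
  have j1 : Continuous fun x => 2 * ((ρ t x * u t x) ^ 2 / ρ t x) := continuous_const.mul i1
  have j2 : Continuous fun x => 2 * (desiredMomentum γ ρ ρ₁ u t x ^ 2 / ρ t x) :=
    continuous_const.mul i2
  calc ∫ x in (0 : ℝ)..1, potentialGrad γ ρ ρ₁ t x ^ 2 / ρ t x
      ≤ ∫ x in (0 : ℝ)..1, (2 * ((ρ t x * u t x) ^ 2 / ρ t x) +
          2 * (desiredMomentum γ ρ ρ₁ u t x ^ 2 / ρ t x)) := by
        refine intervalIntegral.integral_mono_on zero_le_one (i3.intervalIntegrable _ _)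
          ((j1.add j2).intervalIntegrable _ _)
          fun x _ => ?_
        rw [← mul_div_assoc, ← mul_div_assoc, ← add_div]
        refine div_le_div_of_nonneg_right ?_ (S.pos t ht x).le
        simp only [desiredMomentum]
        nlinarith [sq_nonneg (2 * (ρ t x * u t x) + potentialGrad γ ρ ρ₁ t x)]
    _ = 2 * (∫ x in (0 : ℝ)..1, (ρ t x * u t x) ^ 2 / ρ t x) +
          2 * ∫ x in (0 : ℝ)..1, desiredMomentum γ ρ ρ₁ u t x ^ 2 / ρ t x := by
        rw [intervalIntegral.integral_add (j1.intervalIntegrable _ _) (j2.intervalIntegrable _ _),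
          intervalIntegral.integral_const_mul, intervalIntegral.integral_const_mul]
    _ ≤ 4 * D := by linarith

/-- The potential is at most one where `ρ ≤ 1`, which happens somewhere because the mass is at
most one, and its oscillation is at most `∫ |∂ₓ π(ρ)| ≤ ½ ∫ ρ + ½ ∫ (∂ₓ π(ρ))² / ρ`. -/
theorem potential_le (S : IsPeriodicSolution γ T ρ ρ₁ ρ₂ u u₁ u₂)
    (hγ : 0 ≤ γ) (hT : 0 ≤ T)
    (hu : ∫ x in (0 : ℝ)..1, (ρ 0 x * u 0 x) ^ 2 / ρ 0 x ≤ D)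
    (hw : ∫ x in (0 : ℝ)..1, desiredMomentum γ ρ ρ₁ u 0 x ^ 2 / ρ 0 x ≤ D)
    (hm : ∫ x in (0 : ℝ)..1, ρ 0 x ≤ 1) {t : ℝ} (ht : t ∈ Icc 0 T) (x : ℝ) :
    potential γ (ρ t x) ≤ 3 / 2 + 2 * D := by
  have hD := S.integral_sq_potentialGrad_div_le hγ hT hu hw ht
  have hm' := (S.integral_density_le hT ht).trans hm
  have cρ := continuous_slice S.fieldρ.cont ht
  have cπ := continuous_slice S.continuousOn_potentialGrad ht
  have hne : ∀ x, ρ t x ≠ 0 := fun x => (S.pos t ht x).ne'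
  have i3 : Continuous fun x => potentialGrad γ ρ ρ₁ t x ^ 2 / ρ t x := (cπ.pow 2).div cρ hne
  have hperρ : Function.Periodic (ρ t) 1 := S.fieldρ.periodic t
  have hperπ : Function.Periodic (fun x => |potentialGrad γ ρ ρ₁ t x|) 1 := fun x => by
    simp only [potentialGrad, S.fieldρ.periodic, S.fieldρ.periodic₁]
  obtain ⟨x₀, hx₀⟩ : ∃ x₀, ρ t x₀ ≤ 1 := by
    by_contra! hlt
    have h1 : ∫ x in (0 : ℝ)..1, (1 : ℝ) < ∫ x in (0 : ℝ)..1, ρ t x :=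
      intervalIntegral.integral_lt_integral_of_continuousOn_of_le_of_exists_lt zero_lt_one
        continuousOn_const cρ.continuousOn (fun x _ => (hlt x).le)
        ⟨0, ⟨le_rfl, zero_le_one⟩, hlt 0⟩
    simp at h1
    linarith
  obtain ⟨y, hy, hxy⟩ := hperρ.exists_mem_Ico zero_lt_one x x₀
  rw [hxy]
  have hπ₀ : potential γ (ρ t x₀) ≤ 1 := by
    refine mul_le_one₀ ?_ (Real.rpow_nonneg (S.pos t ht x₀).le _)
      (Real.rpow_le_one (S.pos t ht x₀).le hx₀ (by linarith))
    rw [div_le_one (by linarith)]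
    linarith
  have hosc : potential γ (ρ t y) - potential γ (ρ t x₀) ≤
      ∫ x in (0 : ℝ)..1, |potentialGrad γ ρ ρ₁ t x| := by
    rw [← intervalIntegral.integral_eq_sub_of_hasDerivAt
      (fun x _ => S.hasDerivAt_potential hγ ht x) (cπ.intervalIntegrable _ _)]
    calc ∫ x in x₀..y, potentialGrad γ ρ ρ₁ t x
        ≤ ∫ x in x₀..y, |potentialGrad γ ρ ρ₁ t x| :=
          intervalIntegral.integral_mono_on hy.1 (cπ.intervalIntegrable _ _)
            (cπ.abs.intervalIntegrable _ _) fun x _ => le_abs_self _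
      _ ≤ ∫ x in x₀..x₀ + 1, |potentialGrad γ ρ ρ₁ t x| :=
          intervalIntegral.integral_mono_interval le_rfl hy.1 hy.2.le
            (Eventually.of_forall fun x => abs_nonneg _) (cπ.abs.intervalIntegrable _ _)
      _ = _ := by rw [hperπ.intervalIntegral_add_eq x₀ 0, zero_add]
  have hL1 : ∫ x in (0 : ℝ)..1, |potentialGrad γ ρ ρ₁ t x| ≤ 1 / 2 * 1 + 1 / 2 * (4 * D) := by
    have j1 : Continuous fun x => 1 / 2 * ρ t x := continuous_const.mul cρ
    have j2 : Continuous fun x => 1 / 2 * (potentialGrad γ ρ ρ₁ t x ^ 2 / ρ t x) :=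
      continuous_const.mul i3
    calc ∫ x in (0 : ℝ)..1, |potentialGrad γ ρ ρ₁ t x|
        ≤ ∫ x in (0 : ℝ)..1, (1 / 2 * ρ t x +
            1 / 2 * (potentialGrad γ ρ ρ₁ t x ^ 2 / ρ t x)) := by
          refine intervalIntegral.integral_mono_on zero_le_one (cπ.abs.intervalIntegrable _ _)
            ((j1.add j2).intervalIntegrable _ _)
            fun x _ => ?_
          have hp := S.pos t ht x
          rw [← sub_nonneg]
          have : 1 / 2 * ρ t x + 1 / 2 * (potentialGrad γ ρ ρ₁ t x ^ 2 / ρ t x) -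
              |potentialGrad γ ρ ρ₁ t x| =
              (ρ t x - |potentialGrad γ ρ ρ₁ t x|) ^ 2 / (2 * ρ t x) := by
            rw [← sq_abs (potentialGrad γ ρ ρ₁ t x)]
            field_simp
            ring
          rw [this]
          positivity
      _ = 1 / 2 * (∫ x in (0 : ℝ)..1, ρ t x) +
            1 / 2 * ∫ x in (0 : ℝ)..1, potentialGrad γ ρ ρ₁ t x ^ 2 / ρ t x := by
          rw [intervalIntegral.integral_add (j1.intervalIntegrable _ _) (j2.intervalIntegrable _ _),
            intervalIntegral.integral_const_mul, intervalIntegral.integral_const_mul]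
      _ ≤ _ := by gcongr
  linarith

theorem integral_sq_potentialGrad_le (S : IsPeriodicSolution γ T ρ ρ₁ ρ₂ u u₁ u₂)
    (hγ : 0 < γ) (hT : 0 ≤ T)
    (hu : ∫ x in (0 : ℝ)..1, (ρ 0 x * u 0 x) ^ 2 / ρ 0 x ≤ D)
    (hw : ∫ x in (0 : ℝ)..1, desiredMomentum γ ρ ρ₁ u 0 x ^ 2 / ρ 0 x ≤ D)
    (hD : 0 ≤ D) (hm : ∫ x in (0 : ℝ)..1, ρ 0 x ≤ 1) {t : ℝ} (ht : t ∈ Icc 0 T) :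
    ∫ x in (0 : ℝ)..1, potentialGrad γ ρ ρ₁ t x ^ 2 ≤
      (1 + γ⁻¹) * (3 / 2 + 2 * D) * (4 * D) := by
  have hle := S.integral_sq_potentialGrad_div_le hγ.le hT hu hw ht
  have cρ := continuous_slice S.fieldρ.cont ht
  have cπ := continuous_slice S.continuousOn_potentialGrad ht
  have hne : ∀ x, ρ t x ≠ 0 := fun x => (S.pos t ht x).ne'
  have i3 : Continuous fun x => potentialGrad γ ρ ρ₁ t x ^ 2 / ρ t x := (cπ.pow 2).div cρ hne
  calc ∫ x in (0 : ℝ)..1, potentialGrad γ ρ ρ₁ t x ^ 2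
      ≤ ∫ x in (0 : ℝ)..1, (1 + γ⁻¹) * (3 / 2 + 2 * D) *
          (potentialGrad γ ρ ρ₁ t x ^ 2 / ρ t x) := by
        refine intervalIntegral.integral_mono_on zero_le_one ((cπ.pow 2).intervalIntegrable _ _)
          ((continuous_const.mul i3).intervalIntegrable _ _) fun x _ => ?_
        have hp := S.pos t ht x
        have hr := le_of_potential_le hγ (by linarith)
          (S.potential_le hγ.le hT hu hw hm ht x)
        calc potentialGrad γ ρ ρ₁ t x ^ 2 =
              ρ t x * (potentialGrad γ ρ ρ₁ t x ^ 2 / ρ t x) := by field_simp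
          _ ≤ _ := by gcongr
    _ = (1 + γ⁻¹) * (3 / 2 + 2 * D) *
          ∫ x in (0 : ℝ)..1, potentialGrad γ ρ ρ₁ t x ^ 2 / ρ t x :=
        intervalIntegral.integral_const_mul _ _
    _ ≤ _ := by
        have := inv_pos.2 hγ
        gcongr

end IsPeriodicSolution

/-! ### From the torus to the line -/

theorem ContH.isPeriodicC2 {T : ℝ} {f : ℝ → Torus → ℝ} (hf : ContH 4 T f) :
    IsPeriodicC2 T (fun t x => f t (x : Torus)) (fun t => fourierDeriv 1 (f t))
      (fun t => fourierDeriv 2 (f t)) where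
  periodic t x := congrArg (f t) (AddCircle.coe_add_period 1 x)
  periodic₁ t x := by
    have h : ((x + 1 : ℝ) : Torus) = (x : Torus) := AddCircle.coe_add_period 1 x
    simp only [fourierDeriv, h]
  hasDerivAt t ht x := (hasDerivAt_fourierDeriv (k := 0) (by norm_num) (hf.1 t ht) x)
    |>.congr_of_eventuallyEq (Eventually.of_forall fun y => (fourierDeriv_zero (hf.1 t ht) y).symm)
  hasDerivAt₁ t ht x := hasDerivAt_fourierDeriv (k := 1) (by norm_num) (hf.1 t ht) x
  cont := (continuousOn_fourierDeriv (k := 0) (by norm_num) hf).congr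
    fun z hz => (fourierDeriv_zero (hf.1 _ hz.1) z.2).symm
  cont₁ := continuousOn_fourierDeriv (by norm_num) hf
  cont₂ := continuousOn_fourierDeriv (by norm_num) hf

theorem hasDerivAt_comp_coe_add {f : Torus → ℝ} {d x : ℝ}
    (h : HasDerivAt (fun y : ℝ => f (y : Torus)) d x) :
    HasDerivAt (fun y : ℝ => f ((x : Torus) + (y : Torus))) d 0 := by
  have h' : HasDerivAt (fun y : ℝ => f (y : Torus)) d (x + 0) := by rwa [add_zero]
  exact (h'.comp_const_add x 0).congr_of_eventuallyEq
    (Eventually.of_forall fun y => congrArg f (AddCircle.coe_add 1 x y).symm)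

theorem dx_coe {f : Torus → ℝ} {d x : ℝ} (h : HasDerivAt (fun y : ℝ => f (y : Torus)) d x) :
    dx f (x : Torus) = d :=
  (hasDerivAt_comp_coe_add h).deriv

theorem lam_of_pos {γ r : ℝ} (hr : 0 < r) : lam γ r = γ * r ^ (γ + 1) := by
  have h : deriv (p γ) r = γ * r ^ (γ - 1) := (Real.hasDerivAt_rpow_const (Or.inl hr.ne')).deriv
  rw [lam, h, show γ + 1 = γ - 1 + 1 + 1 by ring, Real.rpow_add_one hr.ne', Real.rpow_add_one hr.ne']
  ring

theorem IsRegularSolution.isPeriodicSolution {γ T : ℝ} (hT : 0 ≤ T) {ρ₀ u₀ : Torus → ℝ}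
    {ρ u : ℝ → Torus → ℝ} (S : IsRegularSolution γ T ρ₀ u₀ ρ u) :
    IsPeriodicSolution γ T (fun t x => ρ t (x : Torus)) (fun t => fourierDeriv 1 (ρ t))
      (fun t => fourierDeriv 2 (ρ t)) (fun t x => u t (x : Torus))
      (fun t => fourierDeriv 1 (u t)) (fun t => fourierDeriv 2 (u t)) := by
  have fρ := S.contH_ρ.isPeriodicC2
  have fu := S.contH_u.isPeriodicC2
  have hcont : ∀ t ∈ Icc 0 T, ∀ x : ℝ, HasDerivWithinAt (fun s => ρ s (x : Torus))
      (-(fourierDeriv 1 (ρ t) x * u t (x : Torus) + ρ t (x : Torus) * fourierDeriv 1 (u t) x))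
      (Icc 0 T) t := by
    intro t ht x
    have h := S.continuity_eq t ht x
    rwa [dx_coe ((fρ.hasDerivAt t ht x).mul (fu.hasDerivAt t ht x))] at h
  have hpos := pos_of_continuity_eq hT fρ.periodic fρ.cont fu.cont₁ fρ.hasDerivAt hcont
    fun x => by simpa only [S.initial_ρ] using S.ρ₀_pos x
  refine ⟨fρ, fu, hpos, hcont, fun t ht x => ?_⟩
  refine (S.momentum_eq t ht x).congr_deriv ?_
  have hr := fρ.hasDerivAt t ht x
  have hu := fu.hasDerivAt t ht x
  have h1 := dx_coe (f := fun y => ρ t y * u t y ^ 2) (hr.mul (hu.pow 2))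
  have hlam : HasDerivAt (fun y : ℝ => γ * ρ t (y : Torus) ^ (γ + 1) * fourierDeriv 1 (u t) y)
      (γ * ((γ + 1) * ρ t (x : Torus) ^ γ * fourierDeriv 1 (ρ t) x) * fourierDeriv 1 (u t) x +
        γ * ρ t (x : Torus) ^ (γ + 1) * fourierDeriv 2 (u t) x) x := by
    refine (((hr.rpow_const (Or.inl (hpos t ht x).ne')).const_mul γ).mul
      (fu.hasDerivAt₁ t ht x)).congr_deriv ?_
    rw [add_sub_cancel_right]
    ring
  have h2 := dx_coe (f := fun y => lam γ (ρ t y) * dx (u t) y)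
    (hlam.congr_of_eventuallyEq (Eventually.of_forall fun y => by
      simp only [lam_of_pos (hpos t ht y), dx_coe (fu.hasDerivAt t ht y)]))
  rw [h1, h2]
  simp only [Pi.pow_apply]
  push_cast
  ring

theorem continuous_of_continuous_lift {g : Torus → ℝ} (h : Continuous fun x : ℝ => g (x : Torus)) :
    Continuous g :=
  (QuotientAddGroup.isQuotientMap_mk (N := AddSubgroup.zmultiples (1 : ℝ))).continuous_iff.2 h

theorem eLpNorm_two_torus {g : Torus → ℝ} {h : ℝ → ℝ} (hh : Continuous h)
    (hgh : ∀ x : ℝ, g (x : Torus) = h x) :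
    eLpNorm g 2 volume = ENNReal.ofReal √(∫ x in (0 : ℝ)..1, h x ^ 2) := by
  have hg : Continuous g := continuous_of_continuous_lift (by simpa only [hgh] using hh)
  have hm : MemLp g 2 (volume : Measure Torus) :=
    hg.memLp_of_hasCompactSupport (HasCompactSupport.of_compactSpace _)
  rw [hm.eLpNorm_eq_integral_rpow_norm (by norm_num) (by norm_num)]
  congr 1
  rw [Real.sqrt_eq_rpow]
  have h1 := UnitAddCircle.intervalIntegral_preimage 0 fun x : Torus => g x ^ 2
  simp only [zero_add, hgh] at h1
  rw [h1]
  simp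

theorem integral_sq_le_of_eLpNorm_le {g : Torus → ℝ} {h : ℝ → ℝ} {C : ℝ} (hh : Continuous h)
    (hgh : ∀ x : ℝ, g (x : Torus) = h x) (hC : eLpNorm g 2 volume ≤ ENNReal.ofReal C) :
    ∫ x in (0 : ℝ)..1, h x ^ 2 ≤ C ^ 2 := by
  rw [eLpNorm_two_torus hh hgh, ENNReal.ofReal_le_ofReal_iff'] at hC
  have h0 : 0 ≤ ∫ x in (0 : ℝ)..1, h x ^ 2 :=
    intervalIntegral.integral_nonneg zero_le_one fun _ _ => sq_nonneg _
  have hs := Real.sq_sqrt h0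
  rcases hC with hC | hC
  · rw [← hs]
    exact pow_le_pow_left₀ (Real.sqrt_nonneg _) hC 2
  · rw [← hs, le_antisymm hC (Real.sqrt_nonneg _)]
    nlinarith [sq_nonneg C]

/-- The bounds on the energies at time `0` in terms of the norms of `√ρ₀ u₀` and `√ρ₀ w₀`. -/
theorem IsRegularSolution.initial_energies_le {γ T C : ℝ} (hT : 0 ≤ T)
    {ρ₀ u₀ : Torus → ℝ} {ρ u : ℝ → Torus → ℝ} (S : IsRegularSolution γ T ρ₀ u₀ ρ u)
    (hC : eLpNorm (fun x => √(ρ₀ x) * u₀ x) 2 volume +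
      eLpNorm (fun x => √(ρ₀ x) * desiredVelocity γ ρ₀ u₀ x) 2 volume ≤ ENNReal.ofReal C) :
    ∫ x in (0 : ℝ)..1, (ρ 0 (x : Torus) * u 0 (x : Torus)) ^ 2 / ρ 0 (x : Torus) ≤ C ^ 2 ∧
      ∫ x in (0 : ℝ)..1, desiredMomentum γ (fun t x => ρ t (x : Torus))
        (fun t => fourierDeriv 1 (ρ t)) (fun t x => u t (x : Torus)) 0 x ^ 2 /
          ρ 0 (x : Torus) ≤ C ^ 2 := by
  have P := S.isPeriodicSolution hT
  have h0 : (0 : ℝ) ∈ Icc 0 T := ⟨le_rfl, hT⟩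
  have hpos : ∀ x : ℝ, 0 < ρ 0 (x : Torus) := P.pos 0 h0
  have cρ : Continuous fun x : ℝ => ρ 0 (x : Torus) :=
    continuous_slice (g := fun t (x : ℝ) => ρ t (x : Torus)) P.fieldρ.cont h0
  have cu : Continuous fun x : ℝ => u 0 (x : Torus) :=
    continuous_slice (g := fun t (x : ℝ) => u t (x : Torus)) P.fieldu.cont h0
  have cπ := continuous_slice P.continuousOn_potentialGrad h0
  have cq : Continuous (desiredMomentum γ (fun t x => ρ t (x : Torus))
    (fun t => fourierDeriv 1 (ρ t)) (fun t x => u t (x : Torus)) 0) := (cρ.mul cu).add cπ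
  constructor
  · have h := integral_sq_le_of_eLpNorm_le (h := fun x : ℝ => √(ρ 0 (x : Torus)) * u 0 (x : Torus))
      (cρ.sqrt.mul cu) (fun x => by rw [S.initial_ρ, S.initial_u]) (le_self_add.trans hC)
    refine le_trans (le_of_eq ?_) h
    refine intervalIntegral.integral_congr fun x _ => ?_
    have := (hpos x).ne'
    simp only [mul_pow, Real.sq_sqrt (hpos x).le]
    field_simp
  · have h := integral_sq_le_of_eLpNorm_le (h := fun x : ℝ => √(ρ 0 (x : Torus)) *
      (desiredMomentum γ (fun t x => ρ t (x : Torus)) (fun t => fourierDeriv 1 (ρ t))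
        (fun t x => u t (x : Torus)) 0 x / ρ 0 (x : Torus)))
      (cρ.sqrt.mul (cq.div cρ fun x => (hpos x).ne')) (fun x => ?_) (le_add_self.trans hC)
    · refine le_trans (le_of_eq ?_) h
      refine intervalIntegral.integral_congr fun x _ => ?_
      have := (hpos x).ne'
      simp only [mul_pow, Real.sq_sqrt (hpos x).le]
      field_simp
    · have hp : dx (fun y => p γ (ρ 0 y)) (x : Torus) =
          γ * ρ 0 (x : Torus) ^ (γ - 1) * fourierDeriv 1 (ρ 0) x :=
        dx_coe (P.hasDerivAt_rpow γ h0 x)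
      have e : ρ 0 (x : Torus) ^ γ = ρ 0 (x : Torus) ^ (γ - 1) * ρ 0 (x : Torus) := by
        rw [← Real.rpow_add_one (hpos x).ne', sub_add_cancel]
      have := (hpos x).ne'
      rw [← S.initial_ρ, ← S.initial_u]
      simp only [desiredVelocity, hp, desiredMomentum, potentialGrad, e]
      field_simp

end AwRascle

theorem lemma3p5 (γ : ℕ → ℝ) (hγ_pos : ∀ n, 0 < γ n) (hγ_lim : Tendsto γ atTop atTop)
    (T : ℝ) (hT : 0 < T) (C ρlow ρhat : ℝ) (hρlow : 0 < ρlow) (hρhat : ρhat < 1) :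
    ∃ K : ℝ, ∀ (n : ℕ) (ρ₀ u₀ : AwRascle.Torus → ℝ) (ρ u : ℝ → AwRascle.Torus → ℝ),
      AwRascle.InitialBounds (γ n) C ρlow ρhat ρ₀ u₀ →
      AwRascle.IsRegularSolution (γ n) T ρ₀ u₀ ρ u →
      (∀ t ∈ Icc 0 T, ∀ x : AwRascle.Torus,
        DifferentiableAt ℝ
          (fun h : ℝ => AwRascle.potential (γ n) (ρ t (x + (h : AwRascle.Torus)))) 0) ∧
      AwRascle.normLinftyLq T 1 (fun t x => AwRascle.potential (γ n) (ρ t x)) +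
        AwRascle.normLinftyLq T 2
          (fun t => AwRascle.dx (fun x => AwRascle.potential (γ n) (ρ t x))) ≤
        ENNReal.ofReal K := by
  open AwRascle in
  obtain ⟨A, hA⟩ := (tendsto_inv_atTop_zero.comp hγ_lim).bddAbove_range
  have hA' : ∀ n, (γ n)⁻¹ ≤ A := fun n => hA ⟨n, rfl⟩
  -- Both energies are at most `C²` at time `0`; `A` bounds all `1 / γ n`.
  refine ⟨(3 / 2 + 2 * C ^ 2) + √((1 + A) * (3 / 2 + 2 * C ^ 2) * (4 * C ^ 2)), ?_⟩
  intro n ρ₀ u₀ ρ u hI S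
  have hγ := hγ_pos n
  have P := S.isPeriodicSolution hT.le
  obtain ⟨hu, hw⟩ := S.initial_energies_le hT.le hI.energy
  have hm : ∫ x in (0 : ℝ)..1, ρ 0 (x : Torus) ≤ 1 := by
    have h1 := UnitAddCircle.intervalIntegral_preimage 0 (ρ 0)
    have h2 := hI.mean
    have : IsProbabilityMeasure (volume : Measure Torus) := ⟨UnitAddCircle.measure_univ⟩
    rw [average_eq_integral, ← S.initial_ρ] at h2
    rw [zero_add] at h1
    rw [h1]
    exact h2.trans hρhat.le
  refine ⟨fun t ht x => ?_, ?_⟩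
  · obtain ⟨y, rfl⟩ := QuotientAddGroup.mk_surjective x
    exact (hasDerivAt_comp_coe_add (f := fun x => potential (γ n) (ρ t x))
      (P.hasDerivAt_potential hγ.le ht y)).differentiableAt
  rw [ENNReal.ofReal_add (by positivity) (Real.sqrt_nonneg _)]
  refine add_le_add ?_ ?_
  · refine essSup_le_of_ae_le _ ?_
    filter_upwards [ae_restrict_mem measurableSet_Icc] with t ht
    have h := eLpNorm_le_of_ae_bound (p := 1) (μ := (volume : Measure Torus))
      (f := fun x => potential (γ n) (ρ t x)) (C := 3 / 2 + 2 * C ^ 2)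
      (Eventually.of_forall fun x => by
        obtain ⟨y, rfl⟩ := QuotientAddGroup.mk_surjective x
        rw [Real.norm_of_nonneg]
        · exact P.potential_le hγ.le hT.le hu hw hm ht y
        · have := Real.rpow_nonneg (P.pos t ht y).le (γ n + 1)
          exact mul_nonneg (by positivity) this)
    simpa using h
  · refine essSup_le_of_ae_le _ ?_
    filter_upwards [ae_restrict_mem measurableSet_Icc] with t ht
    rw [eLpNorm_two_torus (continuous_slice P.continuousOn_potentialGrad ht)
      fun x => dx_coe (P.hasDerivAt_potential hγ.le ht x)]
    refine ENNReal.ofReal_le_ofReal (Real.sqrt_le_sqrt ?_)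
    refine (P.integral_sq_potentialGrad_le hγ hT.le hu hw (sq_nonneg C) hm ht).trans ?_
    have := hA' n
    gcongr
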